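/- **Theorem (Hopf Lemma).** Let $n\ge 2$, let $\Omega\subset\mathbb R^n$ be a bounded domain (open and connected), and let $\beta\in(0,1)$. Assume: * $B\in C^{3,\beta}_{loc}((0,\infty))\cap C^1([0,\infty))$, $B(0)=B'(0)=0$, $B,B',B''>0$ on $(0,\infty)$, and there are $p>1$, $k\in[0,1]$, $\gamma,\Gamma>0$ with $\gamma(k+t)^{p-2}t\le B'(t)\le\Gamma(k+t)^{p-2}t$ and $\gamma(k+t)^{p-2}\le B''(t)\le\Gamma(k+t)^{p-2}$ for all $t>0$. * $H:\mathbb R^n\to[0,\infty)$ is even, $H(0)=0$, $H\in C^{3,\beta}_{loc}(\mathbb R^n\setminus\{0\})$, $H(\xi)>0$ and $H(t\xi)=tH(\xi)$ for $\xi\ne0$, $t>0$, and there is $\lambda>0$ with $\langle D^2H(\xi)v,v\rangle\ge\lambda|v|^2$ whenever $H(\xi)=1$ and $\langle\nabla H(\xi),v\rangle=0$. * $f$ is a nonnegative continuous function on $[0,\infty)$, locally Lipschitz on $(0,\infty)$, and there are $\delta>0$ and $g\in C^0([0,\infty))$, non-decreasing on $(0,\delta)$, with $g(0)=0$, $f+g\ge0$,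 and either $g=0$ on $[0,d]$ for some $d>0$, or $\int_0^\delta \frac{ds}{L^{-1}(G(s))}=+\infty$, where $G(s)=\int_0^s g(t)\,dt$ and $L(s)=sB'(s)-B(s)$. Let $u\in C^1(\overline\Omega)$ (that is, $u$ is continuous on $\overline\Omega$ and $C^1$ in $\Omega$, and $\nabla u$ extends continuously to $\overline\Omega$) be a weak solution of $-\operatorname{div}\big(B'(H(\nabla u))\nabla H(\nabla u)\big)=f(u)$ in $\Omega$, i.e. $$\int_\Omega B'(H(\nabla u))\langle\nabla H(\nabla u),\nabla\psi\rangle\,dx=\int_\Omega f(u)\psi\,dx\qquad\text{for all }\psi\in C^1_c(\Omega),$$ with $u>0$ in $\Omega$ and $u=0$ on $\partial\Omega$. Let $y\in\partial\Omega$ be a point at which $\Omega$ satisfies the interior sphere condition: there is an open ball contained in $\Omega$ with $y$ on its boundary. If $\nu$ is the inner unit normal to $\partial\Omega$ at $y$, then the one-sided derivative of $u$ at $y$ in the direction $\nu$ exists and $$\frac{\partial u}{\partial\nu}(y)>0 .$$ Here $\nu$ is the inner unit normal at $y$ if $|\nu|=1$ and, for every $\varepsilon>0$, all $x$ close enough to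 $y$ satisfy: $x\in\Omega$ if $\langle x-y,\nu\rangle>\varepsilon|x-y|$, and $x\notin\Omega$ if $\langle x-y,\nu\rangle<-\varepsilon|x-y|$ (for a $C^1$ boundary this is the usual normal). The same conclusion holds, without requiring that $\partial\Omega$ has a normal at $y$, for the inner unit normal $\nu$ at $y$ of any ball contained in $\Omega$ with $y$ on its boundary. -/

import Mathlib

open Set Filter Topology MeasureTheory
open scoped NNReal ENNReal

noncomputable section

namespace AnisotropicHopf

/-- `φ ∈ C^{3,β}_loc(U)`, for an open set `U`: `φ` is `C³` on `U` and its third derivative is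
`β`-Hölder continuous on every compact subset of `U`. -/
def IsC3HolderLoc {E : Type*} [NormedAddCommGroup E] [NormedSpace ℝ E]
    (β : ℝ≥0) (φ : E → ℝ) (U : Set E) : Prop :=
  ContDiffOn ℝ 3 φ U ∧
    ∀ K : Set E, K ⊆ U → IsCompact K →
      ∃ C : ℝ≥0, HolderOnWith C β (iteratedFDeriv ℝ 3 φ) K

/-- The derivative `B'` of a function `B` on `[0, ∞)`, one-sided at `0`. -/
def dB (B : ℝ → ℝ) : ℝ → ℝ := derivWithin B (Ici 0)

/-- The hypotheses on `B`: regularity, signs, and growth of order `p > 1`. -/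
structure AdmissibleB (β : ℝ≥0) (B : ℝ → ℝ) : Prop where
  holder : IsC3HolderLoc β B (Ioi 0)
  contDiff : ContDiffOn ℝ 1 B (Ici 0)
  zero : B 0 = 0
  deriv_zero : dB B 0 = 0
  pos : ∀ t : ℝ, 0 < t → 0 < B t ∧ 0 < dB B t ∧ 0 < deriv (dB B) t
  growth : ∃ p k γ Γ : ℝ, 1 < p ∧ 0 ≤ k ∧ k ≤ 1 ∧ 0 < γ ∧ 0 < Γ ∧
    ∀ t : ℝ, 0 < t →
      γ * (k + t) ^ (p - 2) * t ≤ dB B t ∧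
      dB B t ≤ Γ * (k + t) ^ (p - 2) * t ∧
      γ * (k + t) ^ (p - 2) ≤ deriv (dB B) t ∧
      deriv (dB B) t ≤ Γ * (k + t) ^ (p - 2)

/-- The hypotheses on the norm `H`: regularity off the origin, evenness, positivity,
homogeneity and uniform ellipticity. By homogeneity `{H = 1}` is the boundary of `{H < 1}`. -/
structure AdmissibleH {n : ℕ} (β : ℝ≥0) (H : EuclideanSpace ℝ (Fin n) → ℝ) : Prop where
  holder : IsC3HolderLoc β H {0}ᶜ
  zero : H 0 = 0
  even : ∀ ξ, H (-ξ) = H ξ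
  pos : ∀ ξ, ξ ≠ 0 → 0 < H ξ
  homogeneous : ∀ ξ, ξ ≠ 0 → ∀ t : ℝ, 0 < t → H (t • ξ) = t * H ξ
  elliptic : ∃ lam : ℝ, 0 < lam ∧ ∀ ξ, H ξ = 1 →
    ∀ v, inner ℝ (gradient H ξ) v = 0 →
      lam * ‖v‖ ^ 2 ≤ fderiv ℝ (fderiv ℝ H) ξ v v

/-- The function `L(s) = s B'(s) - B(s)`; under the hypotheses on `B` it is an increasing
bijection of `[0, ∞)` onto itself. -/
def legendreL (B : ℝ → ℝ) (s : ℝ) : ℝ := s * dB B s - B s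

/-- The inverse of `L` on `[0, ∞)`. -/
def legendreLInv (B : ℝ → ℝ) : ℝ → ℝ := Function.invFunOn (legendreL B) (Ici 0)

/-- The hypotheses on the source `f` on `[0, ∞)`. The last one is the Vázquez type condition; the
integral is an integral of a nonnegative extended real function. -/
structure AdmissibleF (B f : ℝ → ℝ) : Prop where
  continuousOn : ContinuousOn f (Ici 0)
  nonneg : ∀ s : ℝ, 0 ≤ s → 0 ≤ f s
  locallyLipschitz : LocallyLipschitzOn (Ioi 0) f
  vazquez : ∃ (g : ℝ → ℝ) (δ : ℝ), ContinuousOn g (Ici 0) ∧ 0 < δ ∧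
    MonotoneOn g (Ioo 0 δ) ∧ g 0 = 0 ∧ (∀ s : ℝ, 0 ≤ s → 0 ≤ f s + g s) ∧
    ((∃ d : ℝ, 0 < d ∧ ∀ s ∈ Icc 0 d, g s = 0) ∨
      ∫⁻ s in Ioo 0 δ, (ENNReal.ofReal (legendreLInv B (∫ t in (0 : ℝ)..s, g t)))⁻¹ = ⊤)

/-- `u ∈ C¹(closure Ω)`: `u` is continuous on `closure Ω`, differentiable in `Ω`, and its gradient
extends continuously to `closure Ω`. -/
def IsC1Closure {n : ℕ} (Ω : Set (EuclideanSpace ℝ (Fin n)))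
    (u : EuclideanSpace ℝ (Fin n) → ℝ) : Prop :=
  ContinuousOn u (closure Ω) ∧
    ∃ Du : EuclideanSpace ℝ (Fin n) → EuclideanSpace ℝ (Fin n),
      ContinuousOn Du (closure Ω) ∧ ∀ x ∈ Ω, HasGradientAt u (Du x) x

/-- `u` is a weak solution of `-div (B'(H(∇u)) ∇H(∇u)) = f(u)` in `Ω`, tested against `C¹_c(Ω)`.
Where `∇u = 0` the factor `B'(H(0)) = B'(0)` vanishes, so the value of `∇H` at `0` is
irrelevant. -/
def IsWeakSolution {n : ℕ} (B : ℝ → ℝ) (H : EuclideanSpace ℝ (Fin n) → ℝ) (f : ℝ → ℝ)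
    (Ω : Set (EuclideanSpace ℝ (Fin n))) (u : EuclideanSpace ℝ (Fin n) → ℝ) : Prop :=
  ∀ ψ : EuclideanSpace ℝ (Fin n) → ℝ,
    ContDiff ℝ 1 ψ → HasCompactSupport ψ → tsupport ψ ⊆ Ω →
      ∫ x in Ω, dB B (H (gradient u x)) *
          inner ℝ (gradient H (gradient u x)) (gradient ψ x) =
        ∫ x in Ω, f (u x) * ψ x

/-- `Ω` contains a ball of radius `R` that touches `y` and whose inner unit normal at `y`
is `ν`. -/
def IsInteriorSphere {n : ℕ} (Ω : Set (EuclideanSpace ℝ (Fin n)))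
    (y ν : EuclideanSpace ℝ (Fin n)) (R : ℝ) : Prop :=
  0 < R ∧ ‖ν‖ = 1 ∧ Metric.ball (y + R • ν) R ⊆ Ω

/-- The interior sphere condition at `y`: some open ball contained in `Ω` has `y` on its
boundary. -/
def InteriorSphereCondition {n : ℕ} (Ω : Set (EuclideanSpace ℝ (Fin n)))
    (y : EuclideanSpace ℝ (Fin n)) : Prop :=
  ∃ (c : EuclideanSpace ℝ (Fin n)) (R : ℝ), 0 < R ∧ Metric.ball c R ⊆ Ω ∧
    y ∈ Metric.sphere c R

/-- `ν` is the inner unit normal to `∂Ω` at `y`: up to cones of arbitrarily small opening around the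
hyperplane `ν^⊥`, near `y` the set `Ω` is the half-space `⟨x - y, ν⟩ > 0`. For domains with `C¹`
boundary this is the usual inner unit normal. -/
def IsInnerUnitNormal {n : ℕ} (Ω : Set (EuclideanSpace ℝ (Fin n)))
    (y ν : EuclideanSpace ℝ (Fin n)) : Prop :=
  ‖ν‖ = 1 ∧ ∀ ε : ℝ, 0 < ε → ∀ᶠ x in 𝓝 y,
    (ε * ‖x - y‖ < inner ℝ (x - y) ν → x ∈ Ω) ∧
    (inner ℝ (x - y) ν < -(ε * ‖x - y‖) → x ∉ Ω)

/-- The one-sided directional derivative of `u` at `y` in the direction `ν` exists and is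
positive. -/
def HasPosDirDeriv {n : ℕ} (u : EuclideanSpace ℝ (Fin n) → ℝ)
    (y ν : EuclideanSpace ℝ (Fin n)) : Prop :=
  ∃ d : ℝ, HasDerivWithinAt (fun t : ℝ => u (y + t • ν)) d (Ici 0) 0 ∧ 0 < d

end AnisotropicHopf

end

/-!
A positive supersolution `u` is compared with Hopf's barrier `v = ε (exp (-α|x - c|²) - exp (-αR²))`
on an annulus `r < |x - c| < R` inside the touching ball. Since `∇v = m (c - x)` with `m > 0` and
`∇H` is positively homogeneous of degree `0`, the flux `φ (H (∇v)) ∇H(∇v)` equals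
`φ (m H(c - x)) ∇H(c - x)`. Its divergence is, with `z = c - x` and `h = H z`,
`φ'(mh) m (2αh² - |∇H(z)|²) - φ(mh) div ∇H(z)`, and as `φ t ≤ K t φ'(t)` the term `2αh²` dominates
once `α` is large: `v` is a strict subsolution on the annulus. The flux field `φ (H ξ) ∇H(ξ)` is
continuous, also at `ξ = 0`, and it is monotone because `φ` is increasing and `⟨∇H(ξ), η⟩ ≤ H η` by
convexity of `H`. Testing both inequalities with a smooth nondecreasing function of `v - u` which
vanishes where `v - u` is small gives the comparison principle. For `ε` small it yields `v ≤ u` on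
the annulus, and `v` and `u` both vanish at the touching point `y`, where `v` has slope
`m ⟨c - y, ν⟩ > 0`.
-/

namespace AnisotropicHopf

open scoped ContDiff Gradient RealInnerProductSpace

section SuperlevelSet

variable {X : Type*} {U : Set X} {w : X → ℝ}

theorem isCompact_closure_inter_preimage_Ici [PseudoMetricSpace X] [ProperSpace X]
    (hU : Bornology.IsBounded U) (hw : ContinuousOn w (closure U)) (a : ℝ) :
    IsCompact (closure U ∩ w ⁻¹' Ici a) :=
  hU.isCompact_closure.of_isClosed_subset
    (hw.preimage_isClosed_of_isClosed isClosed_closure isClosed_Ici) inter_subset_left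

theorem closure_inter_preimage_Ici_subset [TopologicalSpace X] (hU : IsOpen U)
    (hbd : ∀ x ∈ frontier U, w x ≤ 0) {a : ℝ} (ha : 0 < a) : closure U ∩ w ⁻¹' Ici a ⊆ U := by
  rintro x ⟨hxU, hax : a ≤ w x⟩
  by_contra hx
  exact (ha.trans_le hax).not_ge (hbd x (hU.frontier_eq ▸ ⟨hxU, hx⟩))

theorem frontier_ball_diff_closedBall_subset [PseudoMetricSpace X] (c : X) (r R : ℝ) :
    frontier (Metric.ball c R \ Metric.closedBall c r) ⊆
      Metric.sphere c R ∪ Metric.sphere c r := by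
  rw [Set.sdiff_eq]
  refine (frontier_inter_subset _ _).trans (union_subset_union ?_ ?_)
  · exact inter_subset_left.trans Metric.frontier_ball_subset_sphere
  · rw [frontier_compl]
    exact inter_subset_right.trans Metric.frontier_closedBall_subset_sphere

end SuperlevelSet

section Calculus

variable {E F : Type*} [NormedAddCommGroup E] [NormedSpace ℝ E]
  [NormedAddCommGroup F] [NormedSpace ℝ F]

theorem le_of_hasDerivWithinAt_Ici {f g : ℝ → ℝ} {f' g' a : ℝ}
    (hf : HasDerivWithinAt f f' (Ici a) a) (hg : HasDerivWithinAt g g' (Ici a) a)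
    (ha : f a = g a) (hle : ∀ᶠ t in 𝓝[>] a, f t ≤ g t) : f' ≤ g' := by
  have hf' := hasDerivWithinAt_iff_tendsto_slope.1 hf
  have hg' := hasDerivWithinAt_iff_tendsto_slope.1 hg
  rw [Ici_sdiff_left] at hf' hg'
  refine le_of_tendsto_of_tendsto hf' hg' ?_
  filter_upwards [hle, self_mem_nhdsWithin] with t ht hat
  have hat : 0 ≤ t - a := (sub_pos.2 hat).le
  simp only [slope_def_field, ha]
  gcongr

theorem contDiff_of_tsupport {n : ℕ∞ω} {f : E → F} (hf : ∀ x ∈ tsupport f, ContDiffAt ℝ n f x) :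
    ContDiff ℝ n f :=
  contMDiff_iff_contDiff.1 (contMDiff_of_tsupport fun x hx => (hf x hx).contMDiffAt)

theorem hasDerivAt_add_smul (x v : E) (t : ℝ) : HasDerivAt (fun t : ℝ => x + t • v) v t := by
  simpa using ((hasDerivAt_id t).smul_const v).const_add x

theorem add_fderiv_sub_le_of_fderiv_fderiv_nonneg {f : E → ℝ} {x y : E}
    (hf : ∀ z ∈ segment ℝ x y, ContDiffAt ℝ 2 f z)
    (hf'' : ∀ z ∈ segment ℝ x y, 0 ≤ fderiv ℝ (fderiv ℝ f) z (y - x) (y - x)) :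
    f x + fderiv ℝ f x (y - x) ≤ f y := by
  set ℓ : ℝ → E := fun t => x + t • (y - x) with hℓ
  have hmem : ∀ t ∈ Icc (0 : ℝ) 1, ℓ t ∈ segment ℝ x y := fun t ht => by
    rw [segment_eq_image']
    exact ⟨t, ht, rfl⟩
  have hderiv : ∀ t ∈ Icc (0 : ℝ) 1, HasDerivAt (f ∘ ℓ) (fderiv ℝ f (ℓ t) (y - x)) t :=
    fun t ht => ((hf _ (hmem t ht)).differentiableAt two_ne_zero).hasFDerivAt.comp_hasDerivAt t
      (hasDerivAt_add_smul x (y - x) t)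
  have hderiv₂ : ∀ t ∈ Icc (0 : ℝ) 1, HasDerivAt (fun t => fderiv ℝ f (ℓ t) (y - x))
      (fderiv ℝ (fderiv ℝ f) (ℓ t) (y - x) (y - x)) t := fun t ht => by
    have hdiff : DifferentiableAt ℝ (fderiv ℝ f) (ℓ t) :=
      ((hf _ (hmem t ht)).fderiv_right (m := 1) (by norm_num)).differentiableAt one_ne_zero
    simpa using (hdiff.hasFDerivAt.comp_hasDerivAt t (hasDerivAt_add_smul x (y - x) t)).clm_apply
      (hasDerivAt_const t (y - x))
  have hconv : ConvexOn ℝ (Icc (0 : ℝ) 1) (f ∘ ℓ) :=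
    convexOn_of_hasDerivWithinAt2_nonneg (convex_Icc 0 1)
      (fun t ht => (hderiv t ht).continuousAt.continuousWithinAt)
      (fun t ht => (hderiv t (interior_subset ht)).hasDerivWithinAt)
      (fun t ht => (hderiv₂ t (interior_subset ht)).hasDerivWithinAt)
      (fun t ht => hf'' _ (hmem t (interior_subset ht)))
  have hslope := hconv.le_slope_of_hasDerivAt (x := 0) (y := 1) (by simp) (by simp) one_pos
    (hderiv 0 (by simp))
  simp only [hℓ, slope_def_field, Function.comp_apply, zero_smul, add_zero, one_smul,
    add_sub_cancel, sub_zero, div_one] at hslope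
  linarith

/-- Positive homogeneity of real degree `k`: `f (t x) = t ^ k f x` for `t > 0`. -/
def IsPosHomogeneous (k : ℝ) (f : E → F) : Prop :=
  ∀ t : ℝ, 0 < t → ∀ x, f (t • x) = t ^ k • f x

theorem IsPosHomogeneous.map_zero {k : ℝ} {f : E → F} (hf : IsPosHomogeneous k f) (hk : k ≠ 0) :
    f 0 = 0 := by
  have htwo : (2 : ℝ) ^ k - 1 ≠ 0 := by
    rw [sub_ne_zero, Ne, ← Real.rpow_zero 2, Real.rpow_right_inj two_pos (by norm_num)]
    exact hk
  have h : ((2 : ℝ) ^ k - 1) • f 0 = 0 := by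
    rw [sub_smul, ← hf 2 two_pos 0, smul_zero, one_smul, sub_self]
  exact (smul_eq_zero.1 h).resolve_left htwo

protected theorem IsPosHomogeneous.fderiv {k : ℝ} {f : E → F} (hf : IsPosHomogeneous k f) :
    IsPosHomogeneous (k - 1) (fderiv ℝ f) := by
  intro t ht x
  have hcomp : t • fderiv ℝ f (t • x) = t ^ k • fderiv ℝ f x := by
    rw [← fderiv_comp_smul, funext (hf t ht)]
    exact congrFun (fderiv_const_smul_field (𝕜 := ℝ) (f := f) (t ^ k)) x
  rw [Real.rpow_sub_one ht.ne', div_eq_inv_mul, mul_smul, ← hcomp, inv_smul_smul₀ ht.ne']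

theorem IsPosHomogeneous.fderiv_apply_self {k : ℝ} {f : E → F} (hf : IsPosHomogeneous k f) {x : E}
    (hx : DifferentiableAt ℝ f x) : fderiv ℝ f x x = k • f x := by
  have hray : HasDerivAt (fun t : ℝ => f (t • x)) (fderiv ℝ f x x) 1 := by
    have hid : HasDerivAt (fun t : ℝ => t • x) x 1 := by
      simpa using (hasDerivAt_id (1 : ℝ)).smul_const x
    exact HasFDerivAt.comp_hasDerivAt (1 : ℝ) (by simpa using hx.hasFDerivAt) hid
  have hpow : HasDerivAt (fun t : ℝ => t ^ k • f x) (k • f x) 1 := by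
    simpa using (Real.hasDerivAt_rpow_const (p := k) (Or.inl one_ne_zero)).smul_const (f x)
  refine hray.unique (hpow.congr_of_eventuallyEq ?_)
  filter_upwards [Ioi_mem_nhds (zero_lt_one (α := ℝ))] with t ht using hf t ht x

end Calculus

section Divergence

variable {E : Type*} [NormedAddCommGroup E] [NormedSpace ℝ E]

/-- The divergence of a vector field, as the trace of its derivative. -/
noncomputable def divergence (F : E → E) (x : E) : ℝ :=
  LinearMap.trace ℝ E (fderiv ℝ F x)

theorem divergence_comp_const_sub {F : E → E} {c x : E} (hF : DifferentiableAt ℝ F (c - x)) :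
    divergence (fun x => F (c - x)) x = -divergence F (c - x) := by
  have hderiv : HasFDerivAt (fun x => F (c - x)) (-fderiv ℝ F (c - x)) x := by
    simpa using! hF.hasFDerivAt.comp x ((hasFDerivAt_id x).const_sub c)
  simp [divergence, hderiv.fderiv]

variable [FiniteDimensional ℝ E]

theorem divergence_smul {g : E → ℝ} {F : E → E} {x : E} (hg : DifferentiableAt ℝ g x)
    (hF : DifferentiableAt ℝ F x) :
    divergence (fun x => g x • F x) x = fderiv ℝ g x (F x) + g x * divergence F x := by
  have htrace : LinearMap.trace ℝ E ((fderiv ℝ g x).smulRight (F x)) = fderiv ℝ g x (F x) :=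
    LinearMap.trace_smulRight (fderiv ℝ g x).toLinearMap (F x)
  simp only [divergence, fderiv_fun_smul hg hF, ContinuousLinearMap.toLinearMap_add,
    ContinuousLinearMap.toLinearMap_smul, map_add, map_smul, smul_eq_mul, htrace, add_comm]

theorem continuousAt_divergence {F : E → E} {x : E} (hF : ContDiffAt ℝ 1 F x) :
    ContinuousAt (divergence F) x :=
  have htrace := LinearMap.continuous_of_finiteDimensional
    (LinearMap.trace ℝ E ∘ₗ ContinuousLinearMap.coeLM ℝ)
  htrace.continuousAt.comp (hF.fderiv_right (m := 0) (by norm_num)).continuousAt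

variable [MeasurableSpace E] [BorelSpace E] (μ : Measure E) [μ.IsAddHaarMeasure]

theorem integral_divergence_eq_zero {F : E → E} (hF : ContDiff ℝ 1 F) (hFc : HasCompactSupport F) :
    ∫ x, divergence F x ∂μ = 0 := by
  have hF' : Integrable (fderiv ℝ F) μ :=
    (hF.continuous_fderiv one_ne_zero).integrable_of_hasCompactSupport (hFc.fderiv ℝ)
  have hzero : ∫ x, fderiv ℝ F x ∂μ = 0 := by
    ext v
    rw [ContinuousLinearMap.integral_apply hF']
    have := integral_bilinear_fderiv_right_eq_neg_left_of_integrable (μ := μ) (v := v)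
      (f := fun _ : E => (1 : ℝ)) (g := F) (B := ContinuousLinearMap.lsmul ℝ ℝ)
      (by simp)
      (by simpa using hF'.apply_continuousLinearMap v)
      (by simpa using hF.continuous.integrable_of_hasCompactSupport hFc)
      (fun _ _ => differentiableAt_const _)
      (fun x _ => hF.differentiable one_ne_zero x)
    simpa using this
  let tr : (E →L[ℝ] E) →L[ℝ] ℝ :=
    (LinearMap.trace ℝ E ∘ₗ ContinuousLinearMap.coeLM ℝ).toContinuousLinearMap
  calc ∫ x, divergence F x ∂μ = tr (∫ x, fderiv ℝ F x ∂μ) := tr.integral_comp_comm hF'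
    _ = 0 := by rw [hzero, map_zero]

end Divergence

section TestFunction

variable {E : Type*} [NormedAddCommGroup E] [InnerProductSpace ℝ E]

theorem contDiffOn_gradient [CompleteSpace E] {m n : ℕ∞ω} {f : E → ℝ} {U : Set E}
    (hf : ContDiffOn ℝ n f U) (hU : IsOpen U) (hmn : m + 1 ≤ n) : ContDiffOn ℝ m (∇ f) U :=
  (InnerProductSpace.toDual ℝ E).symm.contDiff.comp_contDiffOn (hf.fderiv_of_isOpen hU hmn)

theorem continuousOn_gradient [CompleteSpace E] {f : E → ℝ} {U : Set E}
    (hf : ContDiffOn ℝ 1 f U) (hU : IsOpen U) : ContinuousOn (∇ f) U :=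
  (contDiffOn_gradient hf hU (zero_add 1).le).continuousOn

/-- Nonnegative `C¹` test functions with compact support in `U`. -/
structure IsNonnegTestFunction (U : Set E) (ψ : E → ℝ) : Prop where
  contDiff : ContDiff ℝ 1 ψ
  hasCompactSupport : HasCompactSupport ψ
  tsupport_subset : tsupport ψ ⊆ U
  nonneg : ∀ x, 0 ≤ ψ x

variable {U V : Set E} {F : E → E} {ψ : E → ℝ}

theorem IsNonnegTestFunction.mono (hψ : IsNonnegTestFunction U ψ) (hUV : U ⊆ V) :
    IsNonnegTestFunction V ψ :=
  { hψ with tsupport_subset := hψ.tsupport_subset.trans hUV }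

variable [FiniteDimensional ℝ E]

theorem tsupport_inner_gradient_subset (F : E → E) (ψ : E → ℝ) :
    tsupport (fun x => ⟪F x, ∇ ψ x⟫) ⊆ tsupport ψ := by
  have hsupport : Function.support (fun x => ⟪F x, ∇ ψ x⟫) ⊆ Function.support (fderiv ℝ ψ) :=
    fun x hx hψx => hx (by simp [gradient, hψx])
  exact (closure_mono hsupport).trans (tsupport_fderiv_subset ℝ)

theorem IsNonnegTestFunction.continuous_inner_gradient (hψ : IsNonnegTestFunction U ψ)
    (hU : IsOpen U) (hF : ContinuousOn F U) : Continuous fun x => ⟪F x, ∇ ψ x⟫ :=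
  (hF.inner (continuousOn_gradient hψ.contDiff.contDiffOn hU)).continuous_of_tsupport_subset hU
    ((tsupport_inner_gradient_subset F ψ).trans hψ.tsupport_subset)

theorem IsNonnegTestFunction.continuous_mul_divergence (hψ : IsNonnegTestFunction U ψ)
    (hU : IsOpen U) (hF : ContDiffOn ℝ 1 F U) : Continuous fun x => ψ x * divergence F x := by
  refine continuous_of_tsupport fun x hx => ?_
  have hxU := hψ.tsupport_subset (tsupport_mul_subset_left hx)
  exact hψ.contDiff.continuous.continuousAt.mul
    (continuousAt_divergence (hF.contDiffAt (hU.mem_nhds hxU)))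

theorem exists_isNonnegTestFunction {w : E → ℝ} (hU : IsOpen U) (hUb : Bornology.IsBounded U)
    (hwc : ContinuousOn w (closure U)) (hw : ContDiffOn ℝ 1 w U)
    (hbd : ∀ x ∈ frontier U, w x ≤ 0) {x₀ : E} (hx₀ : x₀ ∈ U) (hwx₀ : 0 < w x₀) :
    ∃ ψ, IsNonnegTestFunction U ψ ∧ ψ x₀ ≠ 0 ∧
      ∀ x ∈ U, ∃ ρ : ℝ, 0 ≤ ρ ∧ ∇ ψ x = ρ • ∇ w x := by
  set a := w x₀ / 2 with ha
  set T : ℝ → ℝ := fun s => expNegInvGlue (s - a)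
  have hT : ContDiff ℝ 1 T := expNegInvGlue.contDiff.comp (contDiff_id.sub contDiff_const)
  have hTmono : Monotone T := fun s t hst => expNegInvGlue.monotone (sub_le_sub_right hst a)
  set ψ := U.indicator (T ∘ w) with hψ
  have hψw : ∀ x ∈ U, ψ =ᶠ[𝓝 x] T ∘ w := fun x hx => by
    filter_upwards [hU.mem_nhds hx] with z hz using indicator_of_mem hz _
  have hK := isCompact_closure_inter_preimage_Ici hUb hwc a
  have hKU := closure_inter_preimage_Ici_subset hU hbd (half_pos hwx₀)
  have hsupport : tsupport ψ ⊆ closure U ∩ w ⁻¹' Ici a := by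
    refine closure_minimal (fun x hx => ?_) hK.isClosed
    have hxU : x ∈ U := mem_of_indicator_ne_zero hx
    refine ⟨subset_closure hxU, not_lt.1 fun hxa : w x < a => hx ?_⟩
    rw [hψ, indicator_of_mem hxU]
    exact expNegInvGlue.zero_of_nonpos (sub_nonpos.2 hxa.le)
  refine ⟨ψ, ⟨contDiff_of_tsupport fun x hx => ?_, ?_, hsupport.trans hKU, ?_⟩, ?_, ?_⟩
  · have hxU := hKU (hsupport hx)
    exact (hT.contDiffAt.comp x (hw.contDiffAt (hU.mem_nhds hxU))).congr_of_eventuallyEq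
      (hψw x hxU)
  · exact hK.of_isClosed_subset (isClosed_tsupport ψ) hsupport
  · exact fun x => indicator_nonneg (fun x _ => expNegInvGlue.nonneg _) x
  · rw [hψ, indicator_of_mem hx₀]
    exact (expNegInvGlue.pos_of_pos (by rw [ha]; linarith)).ne'
  · refine fun x hx => ⟨deriv T (w x), hTmono.deriv_nonneg, HasGradientAt.gradient ?_⟩
    have hwx := ((hw.contDiffAt (hU.mem_nhds hx)).differentiableAt one_ne_zero).hasFDerivAt
    have hTx := (hT.differentiable one_ne_zero (w x)).hasDerivAt
    rw [hasGradientAt_iff_hasFDerivAt]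
    refine ((hTx.comp_hasFDerivAt x hwx).congr_of_eventuallyEq (hψw x hx)).congr_fderiv ?_
    simp [gradient]

variable [MeasurableSpace E] (μ : Measure E)

theorem IsNonnegTestFunction.setIntegral_inner_gradient (hψ : IsNonnegTestFunction U ψ)
    (F : E → E) : ∫ x in U, ⟪F x, ∇ ψ x⟫ ∂μ = ∫ x, ⟪F x, ∇ ψ x⟫ ∂μ :=
  setIntegral_eq_integral_of_forall_compl_eq_zero fun x hx => by
    by_contra h
    exact hx (hψ.tsupport_subset (tsupport_inner_gradient_subset F ψ (subset_tsupport _ h)))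

variable [BorelSpace E]

theorem IsNonnegTestFunction.integrable_inner_gradient [IsFiniteMeasureOnCompacts μ]
    (hψ : IsNonnegTestFunction U ψ) (hU : IsOpen U) (hF : ContinuousOn F U) :
    Integrable (fun x => ⟪F x, ∇ ψ x⟫) μ :=
  (hψ.continuous_inner_gradient hU hF).integrable_of_hasCompactSupport
    (hψ.hasCompactSupport.of_isClosed_subset (isClosed_tsupport _)
      (tsupport_inner_gradient_subset F ψ))

theorem IsNonnegTestFunction.integrable_mul_divergence [IsFiniteMeasureOnCompacts μ]
    (hψ : IsNonnegTestFunction U ψ) (hU : IsOpen U) (hF : ContDiffOn ℝ 1 F U) :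
    Integrable (fun x => ψ x * divergence F x) μ :=
  (hψ.continuous_mul_divergence hU hF).integrable_of_hasCompactSupport
    hψ.hasCompactSupport.mul_right

theorem IsNonnegTestFunction.integral_inner_gradient_eq_neg [μ.IsAddHaarMeasure]
    (hψ : IsNonnegTestFunction U ψ) (hU : IsOpen U) (hF : ContDiffOn ℝ 1 F U) :
    ∫ x, ⟪F x, ∇ ψ x⟫ ∂μ = -∫ x, ψ x * divergence F x ∂μ := by
  have hF' : ∀ x ∈ tsupport ψ, ContDiffAt ℝ 1 F x := fun x hx =>
    hF.contDiffAt (hU.mem_nhds (hψ.tsupport_subset hx))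
  have hψF : ContDiff ℝ 1 fun x => ψ x • F x := contDiff_of_tsupport fun x hx =>
    hψ.contDiff.contDiffAt.smul (hF' x (tsupport_smul_subset_left ψ F hx))
  have hproduct : ∀ x, divergence (fun x => ψ x • F x) x =
      ⟪F x, ∇ ψ x⟫ + ψ x * divergence F x := fun x => by
    rw [real_inner_comm, inner_gradient_left]
    by_cases hx : x ∈ tsupport ψ
    · exact divergence_smul (hψ.contDiff.differentiable one_ne_zero x)
        ((hF' x hx).differentiableAt one_ne_zero)
    · have hψFx := fun h => hx (tsupport_smul_subset_left ψ F h)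
      simp [divergence, fderiv_of_notMem_tsupport ℝ hψFx, fderiv_of_notMem_tsupport ℝ hx,
        image_eq_zero_of_notMem_tsupport hx]
  have hzero := integral_divergence_eq_zero μ hψF hψ.hasCompactSupport.smul_right
  simp only [hproduct] at hzero
  rw [integral_add (hψ.integrable_inner_gradient μ hU hF.continuousOn)
    (hψ.integrable_mul_divergence μ hU hF)] at hzero
  exact eq_neg_of_add_eq_zero_left hzero

end TestFunction

section WeakSolution

variable {E : Type*} [NormedAddCommGroup E] [InnerProductSpace ℝ E] [FiniteDimensional ℝ E]
  [MeasurableSpace E] [BorelSpace E]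

/-- `u` satisfies `-div A(∇u) ≥ 0` in `U` in the weak sense. -/
def IsWeakSupersolution (A : E → E) (U : Set E) (u : E → ℝ) : Prop :=
  ∀ ψ, IsNonnegTestFunction U ψ → 0 ≤ ∫ x in U, ⟪A (∇ u x), ∇ ψ x⟫

/-- `v` satisfies `-div A(∇v) < 0` in `U` in the weak sense: the inequality is strict for every
nonzero test function. -/
def IsStrictWeakSubsolution (A : E → E) (U : Set E) (v : E → ℝ) : Prop :=
  ∀ ψ, IsNonnegTestFunction U ψ → ψ ≠ 0 → ∫ x in U, ⟪A (∇ v x), ∇ ψ x⟫ < 0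

variable {A : E → E} {U V : Set E} {u v : E → ℝ}

theorem IsWeakSupersolution.mono (hu : IsWeakSupersolution A V u) (hUV : U ⊆ V) :
    IsWeakSupersolution A U u := fun ψ hψ => by
  have h := hu ψ (hψ.mono hUV)
  rwa [(hψ.mono hUV).setIntegral_inner_gradient, ← hψ.setIntegral_inner_gradient] at h

theorem isStrictWeakSubsolution_of_divergence_pos (hU : IsOpen U)
    (hAv : ContDiffOn ℝ 1 (fun x => A (∇ v x)) U)
    (hdiv : ∀ x ∈ U, 0 < divergence (fun x => A (∇ v x)) x) :
    IsStrictWeakSubsolution A U v := fun ψ hψ hψ0 => by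
  rw [hψ.setIntegral_inner_gradient, hψ.integral_inner_gradient_eq_neg volume hU hAv,
    neg_lt_zero]
  have hψU : ∀ x, ψ x ≠ 0 → x ∈ U := fun x hx => hψ.tsupport_subset (subset_tsupport ψ hx)
  obtain ⟨x₀, hx₀⟩ := Function.ne_iff.1 hψ0
  refine (hψ.continuous_mul_divergence hU hAv).integral_pos_of_hasCompactSupport_nonneg_nonzero
    hψ.hasCompactSupport.mul_right (fun x => ?_) (mul_ne_zero hx₀ (hdiv x₀ (hψU x₀ hx₀)).ne')
  by_cases hx : ψ x = 0
  · simp [hx]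
  · exact mul_nonneg (hψ.nonneg x) (hdiv x (hψU x hx)).le

theorem IsStrictWeakSubsolution.le_of_le_on_frontier (hv : IsStrictWeakSubsolution A U v)
    (hu : IsWeakSupersolution A U u) (hA : Continuous A)
    (hAmono : ∀ ξ η, 0 ≤ ⟪A ξ - A η, ξ - η⟫) (hU : IsOpen U) (hUb : Bornology.IsBounded U)
    (hvc : ContinuousOn v (closure U)) (hv₁ : ContDiffOn ℝ 1 v U)
    (huc : ContinuousOn u (closure U)) (hu₁ : ContDiffOn ℝ 1 u U)
    (hbd : ∀ x ∈ frontier U, v x ≤ u x) : ∀ x ∈ U, v x ≤ u x := by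
  by_contra! ⟨x₀, hx₀, hlt⟩
  obtain ⟨ψ, hψ, hψx₀, hψgrad⟩ := exists_isNonnegTestFunction hU hUb (hvc.sub huc) (hv₁.sub hu₁)
    (fun x hx => sub_nonpos.2 (hbd x hx)) hx₀ (sub_pos.2 hlt)
  have hintegrable : ∀ w, ContDiffOn ℝ 1 w U →
      IntegrableOn (fun x => ⟪A (∇ w x), ∇ ψ x⟫) U := fun w hw =>
    (hψ.integrable_inner_gradient volume hU
      (hA.comp_continuousOn (continuousOn_gradient hw hU))).integrableOn
  have hle : ∀ x ∈ U, ⟪A (∇ u x), ∇ ψ x⟫ ≤ ⟪A (∇ v x), ∇ ψ x⟫ := fun x hx => by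
    have hux := (hu₁.contDiffAt (hU.mem_nhds hx)).differentiableAt one_ne_zero
    have hvx := (hv₁.contDiffAt (hU.mem_nhds hx)).differentiableAt one_ne_zero
    obtain ⟨ρ, hρ, hψx⟩ := hψgrad x hx
    have hsub : ∇ (v - u) x = ∇ v x - ∇ u x := by
      simp only [gradient, fderiv_sub hvx hux, map_sub]
    rw [← sub_nonneg, ← inner_sub_left, hψx, hsub, real_inner_smul_right]
    exact mul_nonneg hρ (hAmono _ _)
  refine (hv ψ hψ (fun h => hψx₀ (congrFun h x₀))).not_ge ((hu ψ hψ).trans ?_)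
  exact setIntegral_mono_on (hintegrable u hu₁) (hintegrable v hv₁) hU.measurableSet hle

end WeakSolution

section Convexity

variable {E : Type*} [NormedAddCommGroup E] [NormedSpace ℝ E] {H : E → ℝ} {ξ : E}

theorem IsPosHomogeneous.fderiv_fderiv_nonneg_of_forall_tangent (hhom : IsPosHomogeneous 1 H)
    (hC2 : ContDiffAt ℝ 2 H ξ) (hξ : H ξ ≠ 0)
    (htangent : ∀ w, fderiv ℝ H ξ w = 0 → 0 ≤ fderiv ℝ (fderiv ℝ H) ξ w w) (v : E) :
    0 ≤ fderiv ℝ (fderiv ℝ H) ξ v v := by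
  have hself : fderiv ℝ (fderiv ℝ H) ξ ξ = 0 := by
    have hdiff := (hC2.fderiv_right (m := 1) one_add_one_eq_two.le).differentiableAt one_ne_zero
    rw [hhom.fderiv.fderiv_apply_self hdiff, sub_self, zero_smul]
  have heuler : fderiv ℝ H ξ ξ = H ξ := by
    rw [hhom.fderiv_apply_self (hC2.differentiableAt two_ne_zero), one_smul]
  obtain ⟨a, w, hv, hw⟩ : ∃ (a : ℝ) (w : E), v = a • ξ + w ∧ fderiv ℝ H ξ w = 0 := by
    refine ⟨fderiv ℝ H ξ v / H ξ, _, (add_sub_cancel _ _).symm, ?_⟩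
    rw [map_sub, map_smul, heuler, smul_eq_mul, div_mul_cancel₀ _ hξ, sub_self]
  have hsymm : fderiv ℝ (fderiv ℝ H) ξ w ξ = fderiv ℝ (fderiv ℝ H) ξ ξ w :=
    hC2.isSymmSndFDerivAt (by simp) w ξ
  have hvw : fderiv ℝ (fderiv ℝ H) ξ v v = fderiv ℝ (fderiv ℝ H) ξ w w := by
    simp [hv, hsymm, hself]
  exact hvw ▸ htangent w hw

theorem IsPosHomogeneous.fderiv_apply_le (hhom : IsPosHomogeneous 1 H)
    (hC2 : ContDiffOn ℝ 2 H {0}ᶜ) (hnonneg : ∀ ξ, 0 ≤ H ξ)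
    (hHess : ∀ ξ, ξ ≠ 0 → ∀ v, 0 ≤ fderiv ℝ (fderiv ℝ H) ξ v v) (hξ : ξ ≠ 0) (η : E) :
    fderiv ℝ H ξ η ≤ H η := by
  have hC2At : ∀ ζ ≠ 0, ContDiffAt ℝ 2 H ζ := fun ζ hζ =>
    hC2.contDiffAt (isOpen_compl_singleton.mem_nhds hζ)
  have heuler : fderiv ℝ H ξ ξ = H ξ := by
    rw [hhom.fderiv_apply_self ((hC2At ξ hξ).differentiableAt two_ne_zero), one_smul]
  by_cases hsegment : (0 : E) ∈ segment ℝ ξ η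
  · obtain ⟨a, b, ha, hb, hab, h0⟩ := hsegment
    have hb0 : b ≠ 0 := by
      rintro rfl
      simp_all
    have hD : a * H ξ + b * fderiv ℝ H ξ η = 0 := by
      simpa [heuler] using congrArg (fderiv ℝ H ξ) h0
    have hDη : fderiv ℝ H ξ η ≤ 0 := by
      by_contra! hDη
      have := mul_pos (hb.lt_of_ne' hb0) hDη
      have := mul_nonneg ha (hnonneg ξ)
      linarith
    exact hDη.trans (hnonneg η)
  · have hne : ∀ z ∈ segment ℝ ξ η, z ≠ 0 := fun z hz h => hsegment (h ▸ hz)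
    have h := add_fderiv_sub_le_of_fderiv_fderiv_nonneg (fun z hz => hC2At z (hne z hz))
      (fun z hz => hHess z (hne z hz) (η - ξ))
    rw [map_sub, heuler] at h
    linarith

theorem IsPosHomogeneous.add_le (hhom : IsPosHomogeneous 1 H)
    (hC2 : ContDiffOn ℝ 2 H {0}ᶜ) (hnonneg : ∀ ξ, 0 ≤ H ξ)
    (hHess : ∀ ξ, ξ ≠ 0 → ∀ v, 0 ≤ fderiv ℝ (fderiv ℝ H) ξ v v) (ξ η : E) :
    H (ξ + η) ≤ H ξ + H η := by
  rcases eq_or_ne (ξ + η) 0 with h | h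
  · rw [h, hhom.map_zero one_ne_zero]
    exact add_nonneg (hnonneg ξ) (hnonneg η)
  · have hdiff := (hC2.contDiffAt (isOpen_compl_singleton.mem_nhds h)).differentiableAt two_ne_zero
    calc H (ξ + η) = fderiv ℝ H (ξ + η) (ξ + η) := by
          rw [hhom.fderiv_apply_self hdiff, one_smul]
      _ = fderiv ℝ H (ξ + η) ξ + fderiv ℝ H (ξ + η) η := map_add _ _ _
      _ ≤ H ξ + H η := add_le_add (hhom.fderiv_apply_le hC2 hnonneg hHess h ξ)
          (hhom.fderiv_apply_le hC2 hnonneg hHess h η)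

end Convexity

section AsymmetricNorm

variable {E : Type*} [NormedAddCommGroup E] [InnerProductSpace ℝ E]

/-- A positive, positively homogeneous and subadditive function which is `C²` off the origin.
It need not be even, so it is a norm up to the symmetry `H (-ξ) = H ξ`. -/
structure IsC2AsymmetricNorm (H : E → ℝ) : Prop where
  contDiffOn : ContDiffOn ℝ 2 H {0}ᶜ
  pos : ∀ ξ, ξ ≠ 0 → 0 < H ξ
  isPosHomogeneous : IsPosHomogeneous 1 H
  add_le : ∀ ξ η, H (ξ + η) ≤ H ξ + H η

namespace IsC2AsymmetricNorm

variable {H : E → ℝ} {ξ : E}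

theorem map_smul (hH : IsC2AsymmetricNorm H) {t : ℝ} (ht : 0 < t) (ξ : E) :
    H (t • ξ) = t * H ξ := by
  simpa using hH.isPosHomogeneous t ht ξ

theorem map_zero (hH : IsC2AsymmetricNorm H) : H 0 = 0 :=
  hH.isPosHomogeneous.map_zero one_ne_zero

theorem nonneg (hH : IsC2AsymmetricNorm H) (ξ : E) : 0 ≤ H ξ := by
  rcases eq_or_ne ξ 0 with rfl | hξ
  · exact hH.map_zero.ge
  · exact (hH.pos ξ hξ).le

theorem contDiffAt (hH : IsC2AsymmetricNorm H) (hξ : ξ ≠ 0) : ContDiffAt ℝ 2 H ξ :=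
  hH.contDiffOn.contDiffAt (isOpen_compl_singleton.mem_nhds hξ)

theorem differentiableAt (hH : IsC2AsymmetricNorm H) (hξ : ξ ≠ 0) : DifferentiableAt ℝ H ξ :=
  (hH.contDiffAt hξ).differentiableAt two_ne_zero

variable [FiniteDimensional ℝ E]

theorem contDiffAt_gradient (hH : IsC2AsymmetricNorm H) (hξ : ξ ≠ 0) :
    ContDiffAt ℝ 1 (∇ H) ξ :=
  (contDiffOn_gradient hH.contDiffOn isOpen_compl_singleton one_add_one_eq_two.le).contDiffAt
    (isOpen_compl_singleton.mem_nhds hξ)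

theorem gradient_smul (hH : IsC2AsymmetricNorm H) {t : ℝ} (ht : 0 < t) (ξ : E) :
    ∇ H (t • ξ) = ∇ H ξ := by
  have h := hH.isPosHomogeneous.fderiv t ht ξ
  rw [sub_self, Real.rpow_zero, one_smul] at h
  simp only [gradient, h]

theorem inner_gradient_self (hH : IsC2AsymmetricNorm H) (hξ : ξ ≠ 0) : ⟪∇ H ξ, ξ⟫ = H ξ := by
  rw [inner_gradient_left, hH.isPosHomogeneous.fderiv_apply_self (hH.differentiableAt hξ),
    one_smul]

theorem inner_gradient_le (hH : IsC2AsymmetricNorm H) (hξ : ξ ≠ 0) (η : E) :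
    ⟪∇ H ξ, η⟫ ≤ H η := by
  rw [inner_gradient_left]
  have hleft : HasDerivAt (fun t : ℝ => H (ξ + t • η)) (fderiv ℝ H ξ η) 0 :=
    HasFDerivAt.comp_hasDerivAt (0 : ℝ) (by simpa using (hH.differentiableAt hξ).hasFDerivAt)
      (hasDerivAt_add_smul ξ η 0)
  have hright : HasDerivAt (fun t : ℝ => H ξ + t * H η) (H η) 0 := by
    simpa using ((hasDerivAt_id (0 : ℝ)).mul_const (H η)).const_add (H ξ)
  refine le_of_hasDerivWithinAt_Ici hleft.hasDerivWithinAt hright.hasDerivWithinAt (by simp) ?_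
  filter_upwards [self_mem_nhdsWithin] with t ht
  exact (hH.add_le ξ (t • η)).trans_eq (by rw [hH.map_smul ht])

theorem exists_le_mul_norm (hH : IsC2AsymmetricNorm H) : ∃ M, 0 ≤ M ∧ ∀ ξ, H ξ ≤ M * ‖ξ‖ := by
  have hne : ∀ ξ ∈ Metric.sphere (0 : E) 1, ξ ≠ 0 := fun ξ hξ => by
    simpa using Metric.ne_of_mem_sphere hξ one_ne_zero
  obtain ⟨M, hM⟩ := (isCompact_sphere (0 : E) 1).bddAbove_image
    (hH.contDiffOn.continuousOn.mono hne)
  refine ⟨max M 0, le_max_right _ _, fun ξ => ?_⟩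
  rcases eq_or_ne ξ 0 with rfl | hξ
  · simp [hH.map_zero]
  have hsphere : ‖ξ‖⁻¹ • ξ ∈ Metric.sphere (0 : E) 1 := by simp [norm_smul, hξ]
  calc H ξ = H (‖ξ‖ • ‖ξ‖⁻¹ • ξ) := by rw [smul_inv_smul₀ (norm_ne_zero_iff.2 hξ)]
    _ = ‖ξ‖ * H (‖ξ‖⁻¹ • ξ) := hH.map_smul (norm_pos_iff.2 hξ) _
    _ ≤ ‖ξ‖ * max M 0 := by
      gcongr
      exact le_max_of_le_left (hM (mem_image_of_mem H hsphere))
    _ = max M 0 * ‖ξ‖ := mul_comm _ _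

theorem exists_norm_gradient_le (hH : IsC2AsymmetricNorm H) :
    ∃ M, ∀ ξ, ξ ≠ 0 → ‖∇ H ξ‖ ≤ M := by
  obtain ⟨M, hM, hle⟩ := hH.exists_le_mul_norm
  refine ⟨M, fun ξ hξ => ?_⟩
  rcases eq_or_ne (∇ H ξ) 0 with h | h
  · simpa [h] using hM
  refine le_of_mul_le_mul_right ?_ (norm_pos_iff.2 h)
  rw [← real_inner_self_eq_norm_mul_norm]
  exact (hH.inner_gradient_le hξ _).trans (hle _)

theorem continuous (hH : IsC2AsymmetricNorm H) : Continuous H := by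
  refine continuous_iff_continuousAt.2 fun ξ => ?_
  rcases eq_or_ne ξ 0 with rfl | hξ
  · obtain ⟨M, -, hM⟩ := hH.exists_le_mul_norm
    rw [ContinuousAt, hH.map_zero]
    exact squeeze_zero hH.nonneg hM (by simpa using (continuous_norm.const_mul M).tendsto (0 : E))
  · exact (hH.differentiableAt hξ).continuousAt

end IsC2AsymmetricNorm

end AsymmetricNorm

section Admissible

variable {n : ℕ} {β : ℝ≥0} {H : EuclideanSpace ℝ (Fin n) → ℝ}

theorem AdmissibleH.isPosHomogeneous (hH : AdmissibleH β H) : IsPosHomogeneous 1 H := by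
  intro t ht ξ
  rcases eq_or_ne ξ 0 with rfl | hξ
  · simp [hH.zero]
  · simpa using hH.homogeneous ξ hξ t ht

theorem AdmissibleH.contDiffOn (hH : AdmissibleH β H) : ContDiffOn ℝ 2 H {0}ᶜ :=
  hH.holder.1.of_le (by norm_num)

theorem AdmissibleH.fderiv_fderiv_nonneg (hH : AdmissibleH β H) {ξ : EuclideanSpace ℝ (Fin n)}
    (hξ : ξ ≠ 0) (v : EuclideanSpace ℝ (Fin n)) : 0 ≤ fderiv ℝ (fderiv ℝ H) ξ v v := by
  have hpos := hH.pos ξ hξ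
  have ht := inv_pos.2 hpos
  refine hH.isPosHomogeneous.fderiv_fderiv_nonneg_of_forall_tangent
    (hH.contDiffOn.contDiffAt (isOpen_compl_singleton.mem_nhds hξ)) hpos.ne' (fun w hw => ?_) v
  obtain ⟨lam, hlam, helliptic⟩ := hH.elliptic
  have hD := hH.isPosHomogeneous.fderiv _ ht ξ
  have hD₂ := hH.isPosHomogeneous.fderiv.fderiv _ ht ξ
  have hunit : H ((H ξ)⁻¹ • ξ) = 1 := by
    rw [hH.homogeneous ξ hξ _ ht, inv_mul_cancel₀ hpos.ne']
  have hw₂ := helliptic _ hunit w (by rw [inner_gradient_left, hD]; simp [hw])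
  rw [hD₂] at hw₂
  refine nonneg_of_mul_nonneg_right ((by positivity : (0 : ℝ) ≤ _).trans hw₂) ?_
  exact Real.rpow_pos_of_pos ht _

theorem AdmissibleH.isC2AsymmetricNorm (hH : AdmissibleH β H) : IsC2AsymmetricNorm H where
  contDiffOn := hH.contDiffOn
  pos := hH.pos
  isPosHomogeneous := hH.isPosHomogeneous
  add_le := hH.isPosHomogeneous.add_le hH.contDiffOn
    (fun ξ => (eq_or_ne ξ 0).elim (fun h => (h ▸ hH.zero).ge) fun h => (hH.pos ξ h).le)
    fun _ => hH.fderiv_fderiv_nonneg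

end Admissible

section Profile

/-- The scalar profiles `φ = B'` for which `ξ ↦ φ (H ξ) ∇H(ξ)` obeys the comparison principle and
admits exponential barriers; `φ t ≤ K t φ' t` is what remains of the power growth of `B'`. -/
structure IsEllipticProfile (φ : ℝ → ℝ) : Prop where
  continuousOn : ContinuousOn φ (Ici 0)
  map_zero : φ 0 = 0
  contDiffOn : ContDiffOn ℝ 1 φ (Ioi 0)
  deriv_pos : ∀ t, 0 < t → 0 < deriv φ t
  exists_le_mul_deriv : ∃ K, ∀ t, 0 < t → φ t ≤ K * (t * deriv φ t)

variable {φ : ℝ → ℝ}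

theorem IsEllipticProfile.contDiffAt (hφ : IsEllipticProfile φ) {t : ℝ} (ht : 0 < t) :
    ContDiffAt ℝ 1 φ t :=
  hφ.contDiffOn.contDiffAt (Ioi_mem_nhds ht)

theorem IsEllipticProfile.monotoneOn (hφ : IsEllipticProfile φ) : MonotoneOn φ (Ici 0) := by
  refine (strictMonoOn_of_deriv_pos (convex_Ici 0) hφ.continuousOn fun t ht => ?_).monotoneOn
  exact hφ.deriv_pos t (by simpa using ht)

theorem IsEllipticProfile.nonneg (hφ : IsEllipticProfile φ) {t : ℝ} (ht : 0 ≤ t) : 0 ≤ φ t :=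
  hφ.map_zero.symm.le.trans (hφ.monotoneOn self_mem_Ici ht ht)

variable {β : ℝ≥0} {B : ℝ → ℝ}

theorem AdmissibleB.contDiffOn_dB (hB : AdmissibleB β B) : ContDiffOn ℝ 1 (dB B) (Ioi 0) :=
  (hB.holder.1.deriv_of_isOpen isOpen_Ioi (by norm_num)).congr fun _ ht =>
    derivWithin_of_mem_nhds (Ici_mem_nhds ht)

theorem AdmissibleB.exists_dB_le (hB : AdmissibleB β B) :
    ∃ K, ∀ t, 0 < t → dB B t ≤ K * (t * deriv (dB B) t) := by
  obtain ⟨p, k, γ, Γ, -, -, -, hγ, hΓ, hgrowth⟩ := hB.growth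
  refine ⟨Γ / γ, fun t ht => ?_⟩
  obtain ⟨-, hupper, hlower, -⟩ := hgrowth t ht
  calc dB B t ≤ Γ * (k + t) ^ (p - 2) * t := hupper
    _ = Γ / γ * (t * (γ * (k + t) ^ (p - 2))) := by field_simp
    _ ≤ Γ / γ * (t * deriv (dB B) t) := by gcongr

theorem AdmissibleB.isEllipticProfile (hB : AdmissibleB β B) : IsEllipticProfile (dB B) where
  continuousOn := hB.contDiff.continuousOn_derivWithin (uniqueDiffOn_Ici 0) le_rfl
  map_zero := hB.deriv_zero
  contDiffOn := hB.contDiffOn_dB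
  deriv_pos t ht := (hB.pos t ht).2.2
  exists_le_mul_deriv := hB.exists_dB_le

end Profile

section Flux

variable {E : Type*} [NormedAddCommGroup E] [InnerProductSpace ℝ E] [FiniteDimensional ℝ E]

/-- The vector field `ξ ↦ φ (H ξ) ∇H(ξ)`, which is the gradient of `B ∘ H` when `φ = B'`. -/
noncomputable def flux (φ : ℝ → ℝ) (H : E → ℝ) (ξ : E) : E :=
  φ (H ξ) • ∇ H ξ

variable {φ : ℝ → ℝ} {H : E → ℝ}

theorem flux_zero (hφ : IsEllipticProfile φ) (hH : IsC2AsymmetricNorm H) : flux φ H 0 = 0 := by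
  simp [flux, hH.map_zero, hφ.map_zero]

theorem inner_flux_self (hH : IsC2AsymmetricNorm H) (ξ : E) : ⟪flux φ H ξ, ξ⟫ = φ (H ξ) * H ξ := by
  rcases eq_or_ne ξ 0 with rfl | hξ
  · simp [hH.map_zero]
  · rw [flux, real_inner_smul_left, hH.inner_gradient_self hξ]

theorem inner_flux_le (hφ : IsEllipticProfile φ) (hH : IsC2AsymmetricNorm H) (ξ η : E) :
    ⟪flux φ H ξ, η⟫ ≤ φ (H ξ) * H η := by
  rcases eq_or_ne ξ 0 with rfl | hξ
  · simp [flux_zero hφ hH, hH.map_zero, hφ.map_zero]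
  · rw [flux, real_inner_smul_left]
    exact mul_le_mul_of_nonneg_left (hH.inner_gradient_le hξ η) (hφ.nonneg (hH.nonneg ξ))

theorem inner_flux_sub_flux_nonneg (hφ : IsEllipticProfile φ) (hH : IsC2AsymmetricNorm H)
    (ξ η : E) : 0 ≤ ⟪flux φ H ξ - flux φ H η, ξ - η⟫ := by
  have hmono : 0 ≤ (φ (H ξ) - φ (H η)) * (H ξ - H η) := by
    have hvary := monovaryOn_id_iff.2 hφ.monotoneOn
    exact monovaryOn_iff_forall_mul_nonneg.1 hvary (hH.nonneg η) (hH.nonneg ξ)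
  rw [inner_sub_left, inner_sub_right, inner_sub_right, inner_flux_self hH,
    inner_flux_self hH]
  linarith [inner_flux_le hφ hH ξ η, inner_flux_le hφ hH η ξ]

theorem continuous_flux (hφ : IsEllipticProfile φ) (hH : IsC2AsymmetricNorm H) :
    Continuous (flux φ H) := by
  have hφH : Continuous fun ξ => φ (H ξ) :=
    hφ.continuousOn.comp_continuous hH.continuous hH.nonneg
  refine continuous_iff_continuousAt.2 fun ξ => ?_
  rcases eq_or_ne ξ 0 with rfl | hξ
  · obtain ⟨M, hM⟩ := hH.exists_norm_gradient_le
    have hlim : Tendsto (fun ξ => φ (H ξ) * M) (𝓝 0) (𝓝 0) := by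
      simpa [hH.map_zero, hφ.map_zero] using (hφH.mul_const M).tendsto 0
    rw [ContinuousAt, flux_zero hφ hH]
    refine squeeze_zero_norm (fun ξ => ?_) hlim
    have hnonneg := hφ.nonneg (hH.nonneg ξ)
    rcases eq_or_ne ξ 0 with rfl | hξ
    · simp [flux_zero hφ hH, hH.map_zero, hφ.map_zero]
    · rw [flux, norm_smul, Real.norm_of_nonneg hnonneg]
      exact mul_le_mul_of_nonneg_left (hM ξ hξ) hnonneg
  · exact hφH.continuousAt.smul (hH.contDiffAt_gradient hξ).continuousAt

end Flux

section Barrier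

variable {E : Type*} [NormedAddCommGroup E]

/-- Hopf's radial barrier `ε (exp(-α|x - c|²) - exp(-α r²))`, which vanishes on the sphere of
radius `r` around `c`. -/
noncomputable def barrier (c : E) (r α ε : ℝ) (x : E) : ℝ :=
  ε * (Real.exp (-α * ‖x - c‖ ^ 2) - Real.exp (-α * r ^ 2))

/-- The factor `m` in the identity `∇v(x) = m(x) (c - x)` for the radial barrier `v`. -/
noncomputable def barrierSlope (c : E) (α ε : ℝ) (x : E) : ℝ :=
  2 * α * ε * Real.exp (-α * ‖x - c‖ ^ 2)

variable {c x : E} {r α ε : ℝ}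

theorem barrierSlope_pos (hα : 0 < α) (hε : 0 < ε) : 0 < barrierSlope c α ε x := by
  unfold barrierSlope
  positivity

theorem barrier_le (hα : 0 < α) (hε : 0 < ε) (x : E) : barrier c r α ε x ≤ ε := by
  have hle : Real.exp (-α * ‖x - c‖ ^ 2) ≤ 1 := by
    rw [Real.exp_le_one_iff, neg_mul, neg_nonpos]
    positivity
  exact mul_le_of_le_one_right hε.le (by linarith [Real.exp_pos (-α * r ^ 2)])

theorem barrier_eq_zero {x : E} (hx : x ∈ Metric.sphere c r) : barrier c r α ε x = 0 := by
  simp [barrier, mem_sphere_iff_norm.1 hx]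

variable [InnerProductSpace ℝ E]

theorem contDiff_barrier {k : ℕ∞ω} : ContDiff ℝ k (barrier c r α ε) :=
  contDiff_const.mul ((contDiff_const.mul
    ((contDiff_id.sub contDiff_const).norm_sq ℝ)).exp.sub contDiff_const)

theorem contDiff_barrierSlope {k : ℕ∞ω} : ContDiff ℝ k (barrierSlope c α ε) :=
  contDiff_const.mul (contDiff_const.mul ((contDiff_id.sub contDiff_const).norm_sq ℝ)).exp

theorem hasFDerivAt_exp_neg_mul_norm_sub_sq :
    HasFDerivAt (fun x => Real.exp (-α * ‖x - c‖ ^ 2))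
      ((2 * α * Real.exp (-α * ‖x - c‖ ^ 2)) • innerSL ℝ (c - x)) x := by
  have hnorm : HasFDerivAt (fun x => ‖x - c‖ ^ 2) (2 • innerSL ℝ (x - c)) x := by
    simpa using! ((hasFDerivAt_id x).sub_const c).norm_sq
  refine (hnorm.const_mul (-α)).exp.congr_fderiv ?_
  rw [← neg_sub x c, map_neg]
  module

theorem hasFDerivAt_barrierSlope :
    HasFDerivAt (barrierSlope c α ε) ((2 * α * barrierSlope c α ε x) • innerSL ℝ (c - x)) x := by
  refine (hasFDerivAt_exp_neg_mul_norm_sub_sq.const_mul (2 * α * ε)).congr_fderiv ?_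
  rw [barrierSlope]
  module

variable {φ : ℝ → ℝ} {H : E → ℝ}

theorem contDiffAt_profile_barrierSlope (hφ : IsEllipticProfile φ) (hH : IsC2AsymmetricNorm H)
    (hα : 0 < α) (hε : 0 < ε) (hx : c - x ≠ 0) :
    ContDiffAt ℝ 1 (fun x => φ (barrierSlope c α ε x * H (c - x))) x := by
  have hHx : ContDiffAt ℝ 1 (fun x => H (c - x)) x :=
    ((hH.contDiffAt hx).of_le one_le_two).comp x (contDiffAt_const.sub contDiffAt_id)
  exact (hφ.contDiffAt (mul_pos (barrierSlope_pos hα hε) (hH.pos _ hx))).comp x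
    (contDiff_barrierSlope.contDiffAt.mul hHx)

variable [FiniteDimensional ℝ E]

theorem gradient_barrier : ∇ (barrier c r α ε) x = barrierSlope c α ε x • (c - x) := by
  refine HasGradientAt.gradient (hasGradientAt_iff_hasFDerivAt.2 ?_)
  refine ((hasFDerivAt_exp_neg_mul_norm_sub_sq.sub_const _).const_mul ε).congr_fderiv ?_
  ext v
  simp only [neg_mul, map_sub, smul_apply, sub_apply, coe_innerSL_apply, smul_eq_mul,
    barrierSlope, map_smul, InnerProductSpace.toDual_apply_apply]
  ring

theorem flux_gradient_barrier (hH : IsC2AsymmetricNorm H) (hα : 0 < α) (hε : 0 < ε) (x : E) :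
    flux φ H (∇ (barrier c r α ε) x) =
      φ (barrierSlope c α ε x * H (c - x)) • ∇ H (c - x) := by
  have hm : 0 < barrierSlope c α ε x := barrierSlope_pos hα hε
  rw [flux, gradient_barrier, hH.map_smul hm, hH.gradient_smul hm]

theorem contDiffAt_flux_gradient_barrier (hφ : IsEllipticProfile φ) (hH : IsC2AsymmetricNorm H)
    (hα : 0 < α) (hε : 0 < ε) (hx : c - x ≠ 0) :
    ContDiffAt ℝ 1 (fun x => flux φ H (∇ (barrier c r α ε) x)) x := by
  simp only [flux_gradient_barrier hH hα hε]
  exact (contDiffAt_profile_barrierSlope hφ hH hα hε hx).smul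
    ((hH.contDiffAt_gradient hx).comp x (contDiffAt_const.sub contDiffAt_id))

theorem divergence_flux_gradient_barrier (hφ : IsEllipticProfile φ) (hH : IsC2AsymmetricNorm H)
    (hα : 0 < α) (hε : 0 < ε) (hx : c - x ≠ 0) :
    divergence (fun x => flux φ H (∇ (barrier c r α ε) x)) x =
      deriv φ (barrierSlope c α ε x * H (c - x)) * barrierSlope c α ε x *
          (2 * α * H (c - x) ^ 2 - ‖∇ H (c - x)‖ ^ 2) -
        φ (barrierSlope c α ε x * H (c - x)) * divergence (∇ H) (c - x) := by
  have hHx : HasFDerivAt (fun x => H (c - x)) (-fderiv ℝ H (c - x)) x := by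
    simpa using! (hH.differentiableAt hx).hasFDerivAt.comp x
      ((hasFDerivAt_id (𝕜 := ℝ) x).const_sub c)
  have hm : 0 < barrierSlope c α ε x := barrierSlope_pos hα hε
  have hφx := (hφ.contDiffAt (mul_pos hm (hH.pos _ hx))).differentiableAt one_ne_zero
  have hscalar : HasFDerivAt (fun x => φ (barrierSlope c α ε x * H (c - x)))
      (deriv φ (barrierSlope c α ε x * H (c - x)) •
        (barrierSlope c α ε x • -fderiv ℝ H (c - x) +
          H (c - x) • (2 * α * barrierSlope c α ε x) • innerSL ℝ (c - x))) x :=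
    hφx.hasDerivAt.comp_hasFDerivAt x (hasFDerivAt_barrierSlope.mul hHx)
  have hgradient := (hH.contDiffAt_gradient hx).differentiableAt one_ne_zero
  have hgradient_sub : DifferentiableAt ℝ (fun x => ∇ H (c - x)) x :=
    DifferentiableAt.comp (g := ∇ H) x hgradient (differentiableAt_id.const_sub c)
  simp only [flux_gradient_barrier hH hα hε]
  rw [divergence_smul hscalar.differentiableAt hgradient_sub, divergence_comp_const_sub hgradient,
    hscalar.fderiv]
  have hself : fderiv ℝ H (c - x) (∇ H (c - x)) = ‖∇ H (c - x)‖ ^ 2 := by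
    rw [← inner_gradient_left, real_inner_self_eq_norm_sq]
  have heuler : ⟪c - x, ∇ H (c - x)⟫ = H (c - x) := by
    rw [real_inner_comm, hH.inner_gradient_self hx]
  simp only [smul_neg, smul_add, add_apply, neg_apply, smul_apply, hself, smul_eq_mul,
    coe_innerSL_apply, heuler, mul_neg]
  ring

theorem divergence_flux_gradient_barrier_pos (hφ : IsEllipticProfile φ)
    (hH : IsC2AsymmetricNorm H) {K : ℝ} (hK : ∀ t, 0 < t → φ t ≤ K * (t * deriv φ t))
    (hα : 0 < α) (hε : 0 < ε) (hx : c - x ≠ 0)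
    (hlarge : ‖∇ H (c - x)‖ ^ 2 + K * (H (c - x) * |divergence (∇ H) (c - x)|) <
      2 * α * H (c - x) ^ 2) :
    0 < divergence (fun x => flux φ H (∇ (barrier c r α ε) x)) x := by
  rw [divergence_flux_gradient_barrier hφ hH hα hε hx]
  have hm : 0 < barrierSlope c α ε x := barrierSlope_pos hα hε
  have hh := hH.pos _ hx
  set m := barrierSlope c α ε x
  set h := H (c - x)
  set d := divergence (∇ H) (c - x)
  have hφ' := hφ.deriv_pos _ (mul_pos hm hh)
  rw [sub_pos]
  calc φ (m * h) * d ≤ φ (m * h) * |d| :=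
        mul_le_mul_of_nonneg_left (le_abs_self d) (hφ.nonneg (mul_pos hm hh).le)
    _ ≤ K * (m * h * deriv φ (m * h)) * |d| :=
        mul_le_mul_of_nonneg_right (hK _ (mul_pos hm hh)) (abs_nonneg d)
    _ = deriv φ (m * h) * m * (K * (h * |d|)) := by ring
    _ < deriv φ (m * h) * m * (2 * α * h ^ 2 - ‖∇ H (c - x)‖ ^ 2) := by
        gcongr
        linarith

theorem exists_gradient_sq_add_divergence_lt (hH : IsC2AsymmetricNorm H) (K : ℝ) {s : Set E}
    (hs : IsCompact s) (hs0 : ∀ z ∈ s, z ≠ 0) :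
    ∃ α, 0 < α ∧ ∀ z ∈ s,
      ‖∇ H z‖ ^ 2 + K * (H z * |divergence (∇ H) z|) < 2 * α * H z ^ 2 := by
  have hcont : ContinuousOn
      (fun z => (‖∇ H z‖ ^ 2 + K * (H z * |divergence (∇ H) z|)) / H z ^ 2) s := fun z hz => by
    have hgradient := hH.contDiffAt_gradient (hs0 z hz)
    have hdiv := continuousAt_divergence hgradient
    refine ContinuousAt.continuousWithinAt (.div ?_ (hH.continuous.continuousAt.pow 2)
      (pow_pos (hH.pos z (hs0 z hz)) 2).ne')
    exact (hgradient.continuousAt.norm.pow 2).add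
      (continuousAt_const.mul (hH.continuous.continuousAt.mul hdiv.abs))
  obtain ⟨M, hM⟩ := hs.bddAbove_image hcont
  refine ⟨|M| + 1, by positivity, fun z hz => ?_⟩
  have hHz : 0 < H z ^ 2 := pow_pos (hH.pos z (hs0 z hz)) 2
  have hMα : M < 2 * (|M| + 1) := by linarith [le_abs_self M, abs_nonneg M]
  exact (div_lt_iff₀ hHz).1 ((hM (mem_image_of_mem _ hz)).trans_lt hMα)

theorem exists_isStrictWeakSubsolution_barrier [MeasurableSpace E] [BorelSpace E]
    (hφ : IsEllipticProfile φ) (hH : IsC2AsymmetricNorm H) (c : E) {r₀ : ℝ} (hr₀ : 0 < r₀)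
    (r : ℝ) :
    ∃ α, 0 < α ∧ ∀ ε, 0 < ε →
      IsStrictWeakSubsolution (flux φ H) (Metric.ball c r \ Metric.closedBall c r₀)
        (barrier c r α ε) := by
  obtain ⟨K, hK⟩ := hφ.exists_le_mul_deriv
  have hcompact : IsCompact (Metric.closedBall (0 : E) r \ Metric.ball 0 r₀) :=
    (isCompact_closedBall 0 r).diff Metric.isOpen_ball
  obtain ⟨α, hα, hlarge⟩ := exists_gradient_sq_add_divergence_lt hH K hcompact
    fun z hz hz0 => hz.2 (by simpa [hz0] using hr₀)
  refine ⟨α, hα, fun ε hε => ?_⟩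
  have hmem : ∀ x ∈ Metric.ball c r \ Metric.closedBall c r₀,
      c - x ∈ Metric.closedBall (0 : E) r \ Metric.ball 0 r₀ := fun x hx => by
    simp only [Set.mem_sdiff, Metric.mem_ball', Metric.mem_closedBall', dist_eq_norm, not_le] at hx
    simpa using ⟨hx.1.le, hx.2.le⟩
  have hne : ∀ x ∈ Metric.ball c r \ Metric.closedBall c r₀, c - x ≠ 0 := fun x hx hx0 =>
    (hmem x hx).2 (by simpa [hx0] using hr₀)
  exact isStrictWeakSubsolution_of_divergence_pos
    (Metric.isOpen_ball.sdiff Metric.isClosed_closedBall)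
    (fun x hx => (contDiffAt_flux_gradient_barrier hφ hH hα hε (hne x hx)).contDiffWithinAt)
    fun x hx => divergence_flux_gradient_barrier_pos hφ hH hK hα hε (hne x hx)
      (hlarge _ (hmem x hx))

end Barrier

section Hopf

variable {E : Type*} [NormedAddCommGroup E] [InnerProductSpace ℝ E] {c y w : E}

theorem tendsto_add_smul_nhdsGT_zero (y w : E) :
    Tendsto (fun t : ℝ => y + t • w) (𝓝[>] 0) (𝓝 y) := by
  simpa using (hasDerivAt_add_smul y w 0).continuousAt.tendsto.mono_left nhdsWithin_le_nhds

theorem eventually_add_smul_mem_ball (hw : 0 < ⟪c - y, w⟫) :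
    ∀ᶠ t : ℝ in 𝓝[>] 0, y + t • w ∈ Metric.ball c (dist y c) := by
  have hsmall : ∀ᶠ t : ℝ in 𝓝[>] 0, t * ‖w‖ ^ 2 < 2 * ⟪c - y, w⟫ := by
    have hlim : Tendsto (fun t : ℝ => t * ‖w‖ ^ 2) (𝓝[>] 0) (𝓝 0) := by
      simpa using ((continuous_mul_const (‖w‖ ^ 2)).tendsto (0 : ℝ)).mono_left nhdsWithin_le_nhds
    exact hlim.eventually_lt_const (by positivity)
  filter_upwards [hsmall, self_mem_nhdsWithin] with t ht (ht0 : 0 < t)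
  have hexpand : ‖y + t • w - c‖ ^ 2 =
      ‖y - c‖ ^ 2 + t * (t * ‖w‖ ^ 2 - 2 * ⟪c - y, w⟫) := by
    rw [add_sub_right_comm, norm_add_sq_real, real_inner_smul_right, norm_smul, mul_pow,
      Real.norm_eq_abs, sq_abs, ← neg_sub c y, inner_neg_left]
    ring
  rw [mem_ball_iff_norm, dist_eq_norm]
  refine lt_of_pow_lt_pow_left₀ 2 (norm_nonneg _) ?_
  rw [hexpand]
  linarith [mul_neg_of_pos_of_neg ht0 (sub_neg.2 ht)]

theorem hasDerivAt_barrier_add_smul [FiniteDimensional ℝ E] (r α ε : ℝ) :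
    HasDerivAt (fun t : ℝ => barrier c r α ε (y + t • w))
      (barrierSlope c α ε y * ⟪c - y, w⟫) 0 := by
  have hbarrier : HasFDerivAt (barrier c r α ε) (fderiv ℝ (barrier c r α ε) y)
      (y + (0 : ℝ) • w) := by
    rw [zero_smul, add_zero]
    exact (contDiff_barrier.differentiable one_ne_zero y).hasFDerivAt
  refine (hbarrier.comp_hasDerivAt (0 : ℝ) (hasDerivAt_add_smul y w 0)).congr_deriv ?_
  rw [← inner_gradient_left, gradient_barrier, real_inner_smul_left]

variable {r R α ε : ℝ}

variable [FiniteDimensional ℝ E] [MeasurableSpace E] [BorelSpace E] {φ : ℝ → ℝ} {H u : E → ℝ}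

theorem exists_barrier_le (hφ : IsEllipticProfile φ) (hH : IsC2AsymmetricNorm H) (hr : 0 < r)
    (hrR : r < R) (huc : ContinuousOn u (Metric.closedBall c R))
    (hu₁ : ContDiffOn ℝ 1 u (Metric.ball c R))
    (hu : IsWeakSupersolution (flux φ H) (Metric.ball c R) u)
    (hpos : ∀ x ∈ Metric.ball c R, 0 < u x) :
    ∃ α ε, 0 < α ∧ 0 < ε ∧
      ∀ x ∈ Metric.ball c R \ Metric.closedBall c r, barrier c R α ε x ≤ u x := by
  have hsphere : Metric.sphere c r ⊆ Metric.ball c R :=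
    Metric.sphere_subset_closedBall.trans (Metric.closedBall_subset_ball hrR)
  have hclosure : closure (Metric.ball c R) = Metric.closedBall c R :=
    closure_ball c (hr.trans hrR).ne'
  have hnonneg : ∀ x ∈ Metric.closedBall c R, 0 ≤ u x := fun x hx =>
    le_on_closure (fun x hx => (hpos x hx).le) continuousOn_const (hclosure ▸ huc) (hclosure ▸ hx)
  obtain ⟨ε, hε, hεu⟩ := (isCompact_sphere c r).exists_forall_le'
    (hu₁.continuousOn.mono hsphere) fun x hx => hpos x (hsphere hx)
  obtain ⟨α, hα, hstrict⟩ := exists_isStrictWeakSubsolution_barrier hφ hH c hr R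
  refine ⟨α, ε, hα, hε, ?_⟩
  refine (hstrict ε hε).le_of_le_on_frontier (hu.mono sdiff_subset) (continuous_flux hφ hH)
    (inner_flux_sub_flux_nonneg hφ hH) (Metric.isOpen_ball.sdiff Metric.isClosed_closedBall)
    (Metric.isBounded_ball.subset sdiff_subset) (contDiff_barrier (k := 1)).continuous.continuousOn
    contDiff_barrier.contDiffOn (huc.mono ?_) (hu₁.mono sdiff_subset) fun x hx => ?_
  · exact (closure_mono sdiff_subset).trans hclosure.subset
  · rcases frontier_ball_diff_closedBall_subset c r R hx with hx | hx
    · rw [barrier_eq_zero hx]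
      exact hnonneg x (Metric.sphere_subset_closedBall hx)
    · exact (barrier_le hα hε x).trans (hεu x hx)

theorem pos_of_hasDerivWithinAt_of_mem_sphere (hφ : IsEllipticProfile φ) (hH : IsC2AsymmetricNorm H)
    (hR : 0 < R) (huc : ContinuousOn u (Metric.closedBall c R))
    (hu₁ : ContDiffOn ℝ 1 u (Metric.ball c R))
    (hu : IsWeakSupersolution (flux φ H) (Metric.ball c R) u)
    (hpos : ∀ x ∈ Metric.ball c R, 0 < u x) (hy : y ∈ Metric.sphere c R) (huy : u y = 0)
    (hw : 0 < ⟪c - y, w⟫) {d : ℝ}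
    (hd : HasDerivWithinAt (fun t : ℝ => u (y + t • w)) d (Ici 0) 0) : 0 < d := by
  obtain ⟨α, ε, hα, hε, hle⟩ := exists_barrier_le hφ hH (half_pos hR) (half_lt_self hR) huc hu₁ hu
    hpos
  have hslope : 0 < barrierSlope c α ε y * ⟪c - y, w⟫ := mul_pos (barrierSlope_pos hα hε) hw
  have hbarrier := (hasDerivAt_barrier_add_smul (c := c) (y := y) (w := w) R α ε).hasDerivWithinAt
    (s := Ici 0)
  refine hslope.trans_le (le_of_hasDerivWithinAt_Ici hbarrier hd ?_ ?_)
  · simp [barrier_eq_zero hy, huy]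
  · have hyout : y ∉ Metric.closedBall c (R / 2) := by
      rw [Metric.mem_closedBall, Metric.mem_sphere.1 hy]
      exact (half_lt_self hR).not_ge
    have hball := eventually_add_smul_mem_ball hw
    rw [Metric.mem_sphere.1 hy] at hball
    filter_upwards [hball, (tendsto_add_smul_nhdsGT_zero y w).eventually
      (Metric.isClosed_closedBall.isOpen_compl.mem_nhds hyout)] with t hin hout
    exact hle _ ⟨hin, hout⟩

end Hopf

section Domain

variable {n : ℕ} {Ω : Set (EuclideanSpace ℝ (Fin n))} {u : EuclideanSpace ℝ (Fin n) → ℝ}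
  {y ν w : EuclideanSpace ℝ (Fin n)} {R : ℝ}

theorem IsC1Closure.contDiffOn (hu : IsC1Closure Ω u) (hΩ : IsOpen Ω) : ContDiffOn ℝ 1 u Ω := by
  obtain ⟨-, Du, hDu, hgradient⟩ := hu
  have hfderiv : EqOn (fderiv ℝ u) (InnerProductSpace.toDual ℝ _ ∘ Du) Ω := fun x hx =>
    (hgradient x hx).hasFDerivAt.fderiv
  rw [← zero_add 1, contDiffOn_succ_iff_fderiv_of_isOpen hΩ]
  refine ⟨fun x hx => (hgradient x hx).differentiableAt.differentiableWithinAt, by simp, ?_⟩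
  exact contDiffOn_zero.2 (((InnerProductSpace.toDual ℝ _).continuous.comp_continuousOn
    (hDu.mono subset_closure)).congr hfderiv)

theorem IsC1Closure.exists_hasDerivWithinAt (hu : IsC1Closure Ω u)
    (hw : ∀ᶠ t : ℝ in 𝓝[>] 0, y + t • w ∈ Ω) :
    ∃ d, HasDerivWithinAt (fun t : ℝ => u (y + t • w)) d (Ici 0) 0 := by
  obtain ⟨huc, Du, hDuc, hDu⟩ := hu
  have hline := tendsto_add_smul_nhdsGT_zero y w
  have hy : y ∈ closure Ω := mem_closure_of_tendsto hline hw
  have hderiv : ∀ t : ℝ, y + t • w ∈ Ω →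
      HasDerivAt (fun t : ℝ => u (y + t • w)) ⟪Du (y + t • w), w⟫ t := fun t ht => by
    simpa using! (hDu _ ht).hasFDerivAt.comp_hasDerivAt t (hasDerivAt_add_smul y w t)
  refine ⟨⟪Du y, w⟫, hasDerivWithinAt_Ici_of_tendsto_deriv (s := {t | y + t • w ∈ Ω})
    (fun t ht => (hderiv t ht).differentiableAt.differentiableWithinAt) ?_ hw ?_⟩
  · refine ContinuousWithinAt.comp (t := closure Ω) (by simpa using huc y hy)
      (hasDerivAt_add_smul y w 0).continuousAt.continuousWithinAt fun t ht => subset_closure ht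
  · have hlim : Tendsto (fun t : ℝ => Du (y + t • w)) (𝓝[>] 0) (𝓝 (Du y)) :=
      (hDuc y hy).tendsto.comp
        (tendsto_nhdsWithin_iff.2 ⟨hline, hw.mono fun t ht => subset_closure ht⟩)
    refine (hlim.inner tendsto_const_nhds).congr' ?_
    filter_upwards [hw] with t ht using (hderiv t ht).deriv.symm

theorem IsInteriorSphere.mem_sphere (hS : IsInteriorSphere Ω y ν R) :
    y ∈ Metric.sphere (y + R • ν) R := by
  simp [norm_smul, hS.2.1, hS.1.le]

theorem IsInteriorSphere.eventually_mem (hS : IsInteriorSphere Ω y ν R) (hw : 0 < ⟪ν, w⟫) :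
    ∀ᶠ t : ℝ in 𝓝[>] 0, y + t • w ∈ Ω := by
  have hball : ∀ᶠ t : ℝ in 𝓝[>] 0, y + t • w ∈ Metric.ball (y + R • ν) (dist y (y + R • ν)) :=
    eventually_add_smul_mem_ball (by
      rw [add_sub_cancel_left, real_inner_smul_left]
      exact mul_pos hS.1 hw)
  rw [Metric.mem_sphere.1 hS.mem_sphere] at hball
  exact hball.mono fun t ht => hS.2.2 ht

theorem IsInnerUnitNormal.eventually_notMem (hν : IsInnerUnitNormal Ω y ν) (hw : ⟪w, ν⟫ < 0) :
    ∀ᶠ t : ℝ in 𝓝[>] 0, y + t • w ∉ Ω := by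
  obtain ⟨ε, hε, hεw⟩ := exists_pos_mul_lt (neg_pos.2 hw) ‖w‖
  filter_upwards [(tendsto_add_smul_nhdsGT_zero y w).eventually (hν.2 ε hε), self_mem_nhdsWithin]
    with t ht (ht0 : 0 < t)
  refine ht.2 ?_
  rw [add_sub_cancel_left, real_inner_smul_left, norm_smul, Real.norm_of_nonneg ht0.le]
  linarith [mul_lt_mul_of_pos_left hεw ht0]

theorem IsInnerUnitNormal.eq_of_isInteriorSphere {ν' : EuclideanSpace ℝ (Fin n)}
    (hν : IsInnerUnitNormal Ω y ν) (hS : IsInteriorSphere Ω y ν' R) : ν = ν' := by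
  by_contra hne
  have hlt : ⟪ν, ν'⟫ < 1 := (inner_lt_one_iff_real_of_norm_eq_one hν.1 hS.2.1).2 hne
  have hin : 0 < ⟪ν', ν' - ν⟫ := by
    rw [inner_sub_right, real_inner_self_eq_norm_sq, hS.2.1, real_inner_comm]
    linarith
  have hout : ⟪ν' - ν, ν⟫ < 0 := by
    rw [inner_sub_left, real_inner_self_eq_norm_sq, hν.1, real_inner_comm]
    linarith
  obtain ⟨t, ht, ht'⟩ := ((hS.eventually_mem hin).and (hν.eventually_notMem hout)).exists
  exact ht' ht

theorem InteriorSphereCondition.exists_isInteriorSphere (h : InteriorSphereCondition Ω y) :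
    ∃ ν R, IsInteriorSphere Ω y ν R := by
  obtain ⟨c, R, hR, hball, hy⟩ := h
  refine ⟨R⁻¹ • (c - y), R, hR, ?_, ?_⟩
  · rw [norm_smul, norm_sub_rev, mem_sphere_iff_norm.1 hy, Real.norm_of_nonneg (by positivity),
      inv_mul_cancel₀ hR.ne']
  · rwa [smul_inv_smul₀ hR.ne', add_sub_cancel]

variable {B f : ℝ → ℝ} {H : EuclideanSpace ℝ (Fin n) → ℝ}

theorem IsWeakSolution.isWeakSupersolution (hu : IsWeakSolution B H f Ω u) (hΩ : IsOpen Ω)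
    (hf : ∀ x ∈ Ω, 0 ≤ f (u x)) : IsWeakSupersolution (flux (dB B) H) Ω u := fun ψ hψ => by
  simp only [flux, real_inner_smul_left]
  rw [hu ψ hψ.contDiff hψ.hasCompactSupport hψ.tsupport_subset]
  exact setIntegral_nonneg hΩ.measurableSet fun x hx => mul_nonneg (hf x hx) (hψ.nonneg x)

variable {φ : ℝ → ℝ}

theorem IsInteriorSphere.hasPosDirDeriv (hS : IsInteriorSphere Ω y ν R) (hΩ : IsOpen Ω)
    (hφ : IsEllipticProfile φ) (hH : IsC2AsymmetricNorm H) (hu₁ : IsC1Closure Ω u)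
    (hu : IsWeakSupersolution (flux φ H) Ω u) (hpos : ∀ x ∈ Ω, 0 < u x) (huy : u y = 0) :
    HasPosDirDeriv u y ν := by
  have hνν : ⟪ν, ν⟫ = 1 := by rw [real_inner_self_eq_norm_sq, hS.2.1, one_pow]
  obtain ⟨d, hd⟩ := hu₁.exists_hasDerivWithinAt (hS.eventually_mem (hνν ▸ one_pos))
  have hclosedBall : Metric.closedBall (y + R • ν) R ⊆ closure Ω := by
    rw [← closure_ball _ hS.1.ne']
    exact closure_mono hS.2.2
  refine ⟨d, hd, pos_of_hasDerivWithinAt_of_mem_sphere hφ hH hS.1 (hu₁.1.mono hclosedBall)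
    ((hu₁.contDiffOn hΩ).mono hS.2.2) (hu.mono hS.2.2) (fun x hx => hpos x (hS.2.2 hx))
    hS.mem_sphere huy ?_ hd⟩
  rw [add_sub_cancel_left, real_inner_smul_left, hνν, mul_one]
  exact hS.1

end Domain

end AnisotropicHopf

theorem mainTheorem1_general {n : ℕ} {Ω : Set (EuclideanSpace ℝ (Fin n))} (hΩ : IsOpen Ω)
    {φ : ℝ → ℝ} (hφ : AnisotropicHopf.IsEllipticProfile φ)
    {H : EuclideanSpace ℝ (Fin n) → ℝ} (hH : AnisotropicHopf.IsC2AsymmetricNorm H)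
    {u : EuclideanSpace ℝ (Fin n) → ℝ} (hu₁ : AnisotropicHopf.IsC1Closure Ω u)
    (hu : AnisotropicHopf.IsWeakSupersolution (AnisotropicHopf.flux φ H) Ω u)
    (hpos : ∀ x ∈ Ω, 0 < u x) {y : EuclideanSpace ℝ (Fin n)} (huy : u y = 0)
    (hsphere : AnisotropicHopf.InteriorSphereCondition Ω y) :
    (∀ ν, AnisotropicHopf.IsInnerUnitNormal Ω y ν → AnisotropicHopf.HasPosDirDeriv u y ν) ∧
    (∀ ν R, AnisotropicHopf.IsInteriorSphere Ω y ν R → AnisotropicHopf.HasPosDirDeriv u y ν) := by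
  have hball : ∀ ν R, AnisotropicHopf.IsInteriorSphere Ω y ν R →
      AnisotropicHopf.HasPosDirDeriv u y ν := fun _ _ hS =>
    hS.hasPosDirDeriv hΩ hφ hH hu₁ hu hpos huy
  refine ⟨fun ν hν => ?_, hball⟩
  obtain ⟨ν', R, hS⟩ := hsphere.exists_isInteriorSphere
  rw [hν.eq_of_isInteriorSphere hS]
  exact hball ν' R hS

theorem mainTheorem1 {n : ℕ} (hn : 2 ≤ n)
    (Ω : Set (EuclideanSpace ℝ (Fin n))) (hΩo : IsOpen Ω) (hΩc : IsConnected Ω)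
    (hΩb : Bornology.IsBounded Ω)
    (β : ℝ≥0) (hβ0 : 0 < β) (hβ1 : β < 1)
    (B : ℝ → ℝ) (hB : AnisotropicHopf.AdmissibleB β B)
    (H : EuclideanSpace ℝ (Fin n) → ℝ) (hH : AnisotropicHopf.AdmissibleH β H)
    (f : ℝ → ℝ) (hf : AnisotropicHopf.AdmissibleF B f)
    (u : EuclideanSpace ℝ (Fin n) → ℝ) (huC1 : AnisotropicHopf.IsC1Closure Ω u)
    (husol : AnisotropicHopf.IsWeakSolution B H f Ω u)
    (hupos : ∀ x ∈ Ω, 0 < u x) (hubd : ∀ x ∈ frontier Ω, u x = 0)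
    (y : EuclideanSpace ℝ (Fin n)) (hy : y ∈ frontier Ω)
    (hsphere : AnisotropicHopf.InteriorSphereCondition Ω y) :
    (∀ ν, AnisotropicHopf.IsInnerUnitNormal Ω y ν → AnisotropicHopf.HasPosDirDeriv u y ν) ∧
    (∀ ν R, AnisotropicHopf.IsInteriorSphere Ω y ν R → AnisotropicHopf.HasPosDirDeriv u y ν) := by
  exact mainTheorem1_general hΩo hB.isEllipticProfile hH.isC2AsymmetricNorm huC1
    (husol.isWeakSupersolution hΩo fun x hx => hf.nonneg _ (hupos x hx).le) hupos (hubd y hy)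
    hsphere
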